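/- Let $G$ be a finite simple plane graph with minimum degree $5$ that has no vertices of degree $6$ and no vertices of degree $7$. Suppose that $G$ contains no $\langle 5,5,5,5,\infty\rangle$-star, that is, no vertex of degree five whose neighbors, listed in cyclic order around it from a suitable starting neighbor, have degrees $\le 5$, $\le 5$, $\le 5$, $\le 5$ and arbitrary. Then $G$ contains a minor $5$-star $H$ (a star with five rays, contained in $G$ as a subgraph, whose center has degree at most five in $G$) such that $$\sum_{v\in V(H)} \deg_G(v)\le 44 \quad\text{and}\quad \max_{v\in V(H)} \deg_G(v)\le 15,$$ i.e. a single minor $5$-star of weight at most $44$ and height at most $15$. -/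

import Mathlib

namespace SimpleGraph

variable {V : Type*}

/-- A rotation system of a simple graph: for every vertex `v`, a cyclic order of the darts
(oriented edges) that leave `v`, i.e. of the neighbors of `v`. The permutation `rot` sends a dart
to the next one around its initial vertex. -/
structure RotationSystem (G : SimpleGraph V) where
  /-- the next dart around the same initial vertex -/
  rot : Equiv.Perm G.Dart
  rot_fst : ∀ d : G.Dart, (rot d).fst = d.fst
  rot_cyclic : ∀ d e : G.Dart, d.fst = e.fst → rot.SameCycle d e

namespace RotationSystem

variable {G : SimpleGraph V} (R : G.RotationSystem)

/-- Face tracing: traverse the dart `d` from its initial to its terminal vertex, and leave that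
vertex along the dart that follows the reversal of `d` in the cyclic order. -/
def facePerm : Equiv.Perm G.Dart :=
  (Dart.symm_involutive (G := G)).toPerm.trans R.rot

/-- The facial walks in the connected component `c`, as orbits of face tracing. -/
def facesOf (c : G.ConnectedComponent) : Set (Set G.Dart) :=
  {f | ∃ d : G.Dart, d.fst ∈ c.supp ∧ f = {e | R.facePerm.SameCycle d e}}

/-- The edges in the connected component `c`. -/
def _root_.SimpleGraph.edgesOf (G : SimpleGraph V) (c : G.ConnectedComponent) : Set (Sym2 V) :=
  {e | e ∈ G.edgeSet ∧ ∀ v ∈ e, v ∈ c.supp}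

/-- A rotation system of a finite graph is plane, i.e. it is the system of (say, clockwise) cyclic
orders of an embedding of the graph in the plane, if the closed orientable surface obtained from
each connected component by gluing a disc along each facial walk is a sphere:
`|V| - |E| + |F| = 2`. An isolated vertex, which has no facial walk made of darts, imposes no
condition. -/
def IsPlane : Prop :=
  ∀ c : G.ConnectedComponent, (∃ d : G.Dart, d.fst ∈ c.supp) →
    c.supp.ncard + (R.facesOf c).ncard = (G.edgesOf c).ncard + 2

/-- There is a `⟨κ 0, κ 1, κ 2, κ 3, κ 4⟩`-star: a star whose center has degree five and whose
other vertices, listed in cyclic order around the center (in one of the two directions, from some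
starting neighbor), have degrees at most `κ 0, …, κ 4`. The entry `⊤` stands for no bound. -/
def HasCyclicStar [Fintype V] [DecidableRel G.Adj] (κ : Fin 5 → ℕ∞) : Prop :=
  ∃ d : G.Dart, G.degree d.fst = 5 ∧
    ((∀ i : Fin 5, (G.degree ((R.rot ^ (i : ℕ)) d).snd : ℕ∞) ≤ κ i) ∨
      (∀ i : Fin 5, (G.degree ((R.rot⁻¹ ^ (i : ℕ)) d).snd : ℕ∞) ≤ κ i))

end RotationSystem

namespace Subgraph

variable {G : SimpleGraph V}

/-- `H` is a star with center `c` and `k` rays. -/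
def IsStar (H : G.Subgraph) (c : V) (k : ℕ) : Prop :=
  c ∈ H.verts ∧ (H.verts \ {c}).ncard = k ∧
    ∀ u v : V, H.Adj u v ↔ u ∈ H.verts ∧ v ∈ H.verts ∧ u ≠ v ∧ (u = c ∨ v = c)

variable [Fintype V] [DecidableRel G.Adj]

/-- `H` is a minor `k`-star: a star with `k` rays whose center has degree at most five in `G`. -/
def IsMinorStar (H : G.Subgraph) (k : ℕ) : Prop :=
  ∃ c : V, H.IsStar c k ∧ G.degree c ≤ 5

open Classical in
/-- The weight of a subgraph: the sum of the degrees in `G` of its vertices. -/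
noncomputable def weight (H : G.Subgraph) : ℕ :=
  ∑ v ∈ Finset.univ.filter (fun v => v ∈ H.verts), G.degree v

open Classical in
/-- The height of a subgraph: the maximum of the degrees in `G` of its vertices. -/
noncomputable def height (H : G.Subgraph) : ℕ :=
  (Finset.univ.filter (fun v => v ∈ H.verts)).sup (fun v => G.degree v)

end Subgraph

end SimpleGraph

/-! ### Shares of charge and degree patterns around a vertex of degree five. -/

namespace SimpleGraph

/-! Discharging, by contradiction. Euler's formula gives a negative total when a vertex of degree n
has charge n - 6 and a facial walk of length l has 2l - 6 (`IsPlane.sum_neg`). Only vertices of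
degree five start negative, at -1; all others are major, of degree n ≥ 8. A major vertex sends 1 -
6/n along each edge, to the other end if that has degree five. If both ends are major, the two
shares are pooled and half goes to each side, to the opposite vertex when the face there is a
triangle. Each face divides its charge among its corners.

Without the desired star every vertex of degree five is heavy: its neighbors have total degree at
least 40 or one has degree at least 16, and at most three have degree five. These shares then
suffice at a vertex with only triangular corners, except that it may lack up to 1/8 when its only
major neighbors are non-consecutive, one of degree at least 16, the other 8 or 9
(`HeavyPattern.balance`). Such a poor vertex has two consecutive neighbors of degree five, and one
of them can spare 1/8 (`IsHeavyRotation.exists_support`). Hence all final charges are nonnegative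
(`sum_nonneg_of_degree_eq_five`), a contradiction. -/

/-- The share of the initial charge `n - 6` of a vertex of degree `n` that falls on each of its darts. -/
noncomputable def dartShare (n : ℕ) : ℝ := 1 - 6 / n

/-- The part of its shares that a pair of adjacent vertices of degrees `m` and `n` gives to each of the
two sides of the edge: nothing, unless both are major. -/
noncomputable def sideShare (m n : ℕ) : ℝ :=
  if 8 ≤ m ∧ 8 ≤ n then (dartShare m + dartShare n) / 2 else 0

/-- What a vertex of degree five receives from a neighbor of degree `n`. -/
noncomputable def rayShare (n : ℕ) : ℝ := if 8 ≤ n then dartShare n else 0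

/-- The degrees `n₀, …, n₄` of the neighbors of a vertex of degree five, in one of the two cyclic orders,
are such that it can afford to support the neighbor with degree `n₀`. -/
def SupportPattern (n₀ n₁ n₂ n₃ n₄ : ℕ) : Prop :=
  n₀ = 5 ∧ ((8 ≤ n₁ ∧ 8 ≤ n₂ ∧ 8 ≤ n₃ ∧ n₄ = 5) ∨
    (n₁ = 5 ∧ 16 ≤ n₄ ∧ ((n₂ = 5 ∧ 8 ≤ n₃) ∨ 16 ≤ n₂)))

/-- The degrees of the neighbors of a vertex of degree five whose major neighbors may give too little. -/
def PoorPattern (n₀ n₁ n₂ n₃ n₄ : ℕ) : Prop :=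
  16 ≤ n₀ ∧ n₁ = 5 ∧ 8 ≤ n₂ ∧ n₂ ≤ 9 ∧ n₃ = 5 ∧ n₄ = 5

/-- The degrees around a vertex of degree five that is not the center of a star of weight at most 44 and
height at most 15, in a graph without vertices of degrees 6 and 7, with at most three neighbors of degree
five. -/
structure HeavyPattern (n₀ n₁ n₂ n₃ n₄ : ℕ) : Prop where
  h₀ : n₀ = 5 ∨ 8 ≤ n₀
  h₁ : n₁ = 5 ∨ 8 ≤ n₁
  h₂ : n₂ = 5 ∨ 8 ≤ n₂
  h₃ : n₃ = 5 ∨ 8 ≤ n₃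
  h₄ : n₄ = 5 ∨ 8 ≤ n₄
  heavy : 40 ≤ n₀ + n₁ + n₂ + n₃ + n₄ ∨ 16 ≤ n₀ ∨ 16 ≤ n₁ ∨ 16 ≤ n₂ ∨ 16 ≤ n₃ ∨ 16 ≤ n₄
  major₀ : 8 ≤ n₁ ∨ 8 ≤ n₂ ∨ 8 ≤ n₃ ∨ 8 ≤ n₄
  major₁ : 8 ≤ n₀ ∨ 8 ≤ n₂ ∨ 8 ≤ n₃ ∨ 8 ≤ n₄
  major₂ : 8 ≤ n₀ ∨ 8 ≤ n₁ ∨ 8 ≤ n₃ ∨ 8 ≤ n₄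
  major₃ : 8 ≤ n₀ ∨ 8 ≤ n₁ ∨ 8 ≤ n₂ ∨ 8 ≤ n₄
  major₄ : 8 ≤ n₀ ∨ 8 ≤ n₁ ∨ 8 ≤ n₂ ∨ 8 ≤ n₃

lemma HeavyPattern.rotate {n₀ n₁ n₂ n₃ n₄ : ℕ} (h : HeavyPattern n₀ n₁ n₂ n₃ n₄) :
    HeavyPattern n₁ n₂ n₃ n₄ n₀ := by
  obtain ⟨a, b, c, d, e, f, g, i, j, k, l⟩ := h
  constructor <;> first | assumption | omega

lemma quarter_le_dartShare {n : ℕ} (h : 8 ≤ n) : 1 / 4 ≤ dartShare n := by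
  have : (8 : ℝ) ≤ n := by exact_mod_cast h
  rw [dartShare, le_sub_comm, div_le_iff₀ (by positivity)]
  linarith

lemma five_eighths_le_dartShare {n : ℕ} (h : 16 ≤ n) : 5 / 8 ≤ dartShare n := by
  have : (16 : ℝ) ≤ n := by exact_mod_cast h
  rw [dartShare, le_sub_comm, div_le_iff₀ (by positivity)]
  linarith

/-- The chord of the concave function 1 - 6/n over [8, 15]: a linear bound, so that shares can be
added knowing only the sum of the degrees. -/
lemma dartShare_lower_eight {n : ℕ} (h : 8 ≤ n) (h' : n ≤ 15) :
    1 / 4 + ((n : ℝ) - 8) / 20 ≤ dartShare n := by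
  interval_cases n <;> norm_num [dartShare]

/-- From (m - 10)(n - 10) ≥ 0 follows mn ≥ 10(m + n) - 100, which is at least 6(m + n) once m + n ≥
25. Equality holds at 10 and 15. -/
lemma one_le_dartShare_add {m n : ℕ} (hm : 10 ≤ m) (hn : 10 ≤ n) (h : 25 ≤ m + n) :
    1 ≤ dartShare m + dartShare n := by
  have h1 : (10 : ℝ) ≤ m := by exact_mod_cast hm
  have h2 : (10 : ℝ) ≤ n := by exact_mod_cast hn
  have h3 : (25 : ℝ) ≤ m + n := by exact_mod_cast h
  have : (6 : ℝ) / m + 6 / n ≤ 1 := by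
    rw [div_add_div _ _ (by positivity) (by positivity), div_le_one (by positivity)]
    nlinarith [mul_nonneg (sub_nonneg.2 h1) (sub_nonneg.2 h2)]
  rw [dartShare, dartShare]; linarith

/-- Two major neighbors of a heavy vertex. -/
lemma dartShare_two {a b : ℕ} (ha : 8 ≤ a) (hb : 8 ≤ b) (h : 25 ≤ a + b ∨ 16 ≤ a ∨ 16 ≤ b) :
    1 ≤ dartShare a + dartShare b ∨ (7 / 8 ≤ dartShare a + dartShare b ∧
      ((16 ≤ a ∧ b ≤ 9) ∨ (16 ≤ b ∧ a ≤ 9))) := by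
  have := quarter_le_dartShare ha
  have := quarter_le_dartShare hb
  by_cases ha' : 10 ≤ a
  · by_cases hb' : 10 ≤ b
    · exact .inl (one_le_dartShare_add ha' hb' (by omega))
    · have := five_eighths_le_dartShare (n := a) (by omega)
      exact .inr ⟨by linarith, .inl ⟨by omega, by omega⟩⟩
  · have := five_eighths_le_dartShare (n := b) (by omega)
    exact .inr ⟨by linarith, .inr ⟨by omega, by omega⟩⟩

/-- Three major neighbors of a heavy vertex. -/
lemma dartShare_three {a b c : ℕ} (ha : 8 ≤ a) (hb : 8 ≤ b) (hc : 8 ≤ c)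
    (h : 30 ≤ a + b + c ∨ 16 ≤ a ∨ 16 ≤ b ∨ 16 ≤ c) :
    1 ≤ dartShare a + dartShare b + dartShare c := by
  have := quarter_le_dartShare ha
  have := quarter_le_dartShare hb
  have := quarter_le_dartShare hc
  by_cases ha' : 16 ≤ a
  · linarith [five_eighths_le_dartShare ha']
  by_cases hb' : 16 ≤ b
  · linarith [five_eighths_le_dartShare hb']
  by_cases hc' : 16 ≤ c
  · linarith [five_eighths_le_dartShare hc']
  have h' : (30 : ℝ) ≤ a + b + c := by exact_mod_cast (show 30 ≤ a + b + c by omega)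
  linarith [dartShare_lower_eight ha (by omega), dartShare_lower_eight hb (by omega),
    dartShare_lower_eight hc (by omega)]

lemma sideShare_nonneg (m n : ℕ) : 0 ≤ sideShare m n := by
  unfold sideShare
  split_ifs with h
  · linarith [quarter_le_dartShare h.1, quarter_le_dartShare h.2]
  · rfl

lemma rayShare_nonneg (n : ℕ) : 0 ≤ rayShare n := by
  unfold rayShare
  split_ifs with h
  · linarith [quarter_le_dartShare h]
  · rfl

open Classical in
/-- The amount a vertex of degree five with triangular corners pays to the neighbor of degree `n₀`. -/
noncomputable def patternPayment (n₀ n₁ n₂ n₃ n₄ : ℕ) : ℝ :=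
  if SupportPattern n₀ n₁ n₂ n₃ n₄ ∨ SupportPattern n₀ n₄ n₃ n₂ n₁ then 1 / 8 else 0

/-- The balance of a vertex of degree five with triangular corners, without the payments it receives. -/
noncomputable def patternBalance (n₀ n₁ n₂ n₃ n₄ : ℕ) : ℝ :=
  -1 + (rayShare n₀ + rayShare n₁ + rayShare n₂ + rayShare n₃ + rayShare n₄) +
    (sideShare n₀ n₁ + sideShare n₁ n₂ + sideShare n₂ n₃ + sideShare n₃ n₄ + sideShare n₄ n₀) -
    (patternPayment n₀ n₁ n₂ n₃ n₄ + patternPayment n₁ n₂ n₃ n₄ n₀ + patternPayment n₂ n₃ n₄ n₀ n₁ +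
      patternPayment n₃ n₄ n₀ n₁ n₂ + patternPayment n₄ n₀ n₁ n₂ n₃)

lemma patternBalance_rotate (n₀ n₁ n₂ n₃ n₄ : ℕ) :
    patternBalance n₁ n₂ n₃ n₄ n₀ = patternBalance n₀ n₁ n₂ n₃ n₄ := by
  unfold patternBalance; ring

/-- Some rotation of a cyclic sequence of length five has property `P`. -/
def SomeRotation (P : ℕ → ℕ → ℕ → ℕ → ℕ → Prop) (n₀ n₁ n₂ n₃ n₄ : ℕ) : Prop :=
  P n₀ n₁ n₂ n₃ n₄ ∨ P n₁ n₂ n₃ n₄ n₀ ∨ P n₂ n₃ n₄ n₀ n₁ ∨ P n₃ n₄ n₀ n₁ n₂ ∨ P n₄ n₀ n₁ n₂ n₃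

/-- A cyclic sequence with at most three entries equal to 5 has a rotation in one of six normal forms. -/
lemma HeavyPattern.someRotation {n₀ n₁ n₂ n₃ n₄ : ℕ} (h : HeavyPattern n₀ n₁ n₂ n₃ n₄) :
    SomeRotation (fun a b c d e => HeavyPattern a b c d e ∧
      ((8 ≤ b ∧ 8 ≤ c ∧ 8 ≤ d ∧ 8 ≤ e) ∨ (a = 5 ∧ b = 5 ∧ 8 ≤ c ∧ 8 ≤ d ∧ 8 ≤ e) ∨
       (a = 5 ∧ 8 ≤ b ∧ c = 5 ∧ 8 ≤ d ∧ 8 ≤ e) ∨ (a = 5 ∧ b = 5 ∧ c = 5 ∧ 8 ≤ d ∧ 8 ≤ e) ∨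
       (a = 5 ∧ b = 5 ∧ 8 ≤ c ∧ d = 5 ∧ 8 ≤ e))) n₀ n₁ n₂ n₃ n₄ := by
  simp only [SomeRotation, h, h.rotate, h.rotate.rotate, h.rotate.rotate.rotate,
    h.rotate.rotate.rotate.rotate, true_and]
  obtain ⟨a, b, c, d, e, -, i, j, k, l, m⟩ := h
  rcases a with a | a <;> rcases b with b | b <;> rcases c with c | c <;> rcases d with d | d <;>
    rcases e with e | e <;> simp_all
end SimpleGraph

/-! ### The balance of a heavy pattern, case by case. -/

namespace SimpleGraph

lemma patternPayment_le (n₀ n₁ n₂ n₃ n₄ : ℕ) : patternPayment n₀ n₁ n₂ n₃ n₄ ≤ 1 / 8 := by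
  unfold patternPayment; split_ifs <;> norm_num

lemma patternPayment_eq_zero {n₀ n₁ n₂ n₃ n₄ : ℕ} (h : ¬ SupportPattern n₀ n₁ n₂ n₃ n₄)
    (h' : ¬ SupportPattern n₀ n₄ n₃ n₂ n₁) : patternPayment n₀ n₁ n₂ n₃ n₄ = 0 :=
  if_neg (by tauto)

lemma rayShare_five : rayShare 5 = 0 := by simp [rayShare]

lemma rayShare_of_le {n : ℕ} (h : 8 ≤ n) : rayShare n = dartShare n := if_pos h

lemma sideShare_of_le {m n : ℕ} (hm : 8 ≤ m) (hn : 8 ≤ n) :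
    sideShare m n = (dartShare m + dartShare n) / 2 := if_pos ⟨hm, hn⟩

/-- A heavy vertex gets enough directly from its major neighbors, unless its degree pattern is poor or it
has two consecutive major neighbors. -/
lemma patternBalance_nonneg_or_poor_of_normal {a b c d e : ℕ} (h : HeavyPattern a b c d e)
    (hn : (8 ≤ b ∧ 8 ≤ c ∧ 8 ≤ d ∧ 8 ≤ e) ∨ (a = 5 ∧ b = 5 ∧ 8 ≤ c ∧ 8 ≤ d ∧ 8 ≤ e) ∨
       (a = 5 ∧ 8 ≤ b ∧ c = 5 ∧ 8 ≤ d ∧ 8 ≤ e) ∨ (a = 5 ∧ b = 5 ∧ c = 5 ∧ 8 ≤ d ∧ 8 ≤ e) ∨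
       (a = 5 ∧ b = 5 ∧ 8 ≤ c ∧ d = 5 ∧ 8 ≤ e)) :
    7 / 8 ≤ rayShare a + rayShare b + rayShare c + rayShare d + rayShare e ∧
    (0 ≤ patternBalance a b c d e ∨
      -(1 / 8) ≤ patternBalance a b c d e ∧ (PoorPattern c d e a b ∨ PoorPattern e d c b a)) := by
  have heavy := h.heavy
  have s0 := sideShare_nonneg a b
  have s1 := sideShare_nonneg b c
  have s2 := sideShare_nonneg c d
  have s3 := sideShare_nonneg d e
  have s4 := sideShare_nonneg e a
  have p0 := patternPayment_le a b c d e
  have p1 := patternPayment_le b c d e a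
  have p2 := patternPayment_le c d e a b
  have p3 := patternPayment_le d e a b c
  have p4 := patternPayment_le e a b c d
  have zero : ∀ {n₀ n₁ n₂ n₃ n₄ : ℕ}, ¬ SupportPattern n₀ n₁ n₂ n₃ n₄ →
    ¬ SupportPattern n₀ n₄ n₃ n₂ n₁ → patternPayment n₀ n₁ n₂ n₃ n₄ = 0 := patternPayment_eq_zero
  unfold patternBalance
  rcases hn with ⟨hb, hc, hd, he⟩ | ⟨rfl, rfl, hc, hd, he⟩ | ⟨rfl, hb, rfl, hd, he⟩ |
    ⟨rfl, rfl, rfl, hd, he⟩ | ⟨rfl, rfl, hc, rfl, he⟩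
  · rw [zero (n₀ := a), zero (n₀ := b), zero (n₀ := c), zero (n₀ := d), zero (n₀ := e)]
    · have := rayShare_nonneg a
      have := quarter_le_dartShare hb
      have := quarter_le_dartShare hc
      have := quarter_le_dartShare hd
      have := quarter_le_dartShare he
      rw [rayShare_of_le hb, rayShare_of_le hc, rayShare_of_le hd, rayShare_of_le he]
      exact ⟨by linarith, .inl (by linarith)⟩
    all_goals unfold SupportPattern; omega
  · rw [zero (n₀ := c), zero (n₀ := d), zero (n₀ := e)]
    · have := dartShare_three hc hd he (by omega)
      have := quarter_le_dartShare hc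
      have := quarter_le_dartShare hd
      -- The two neighbors of degree five may cost 2/8; the side share of `c` and `d` is already at
      -- least 1/4.
      have := sideShare_of_le hc hd
      rw [rayShare_of_le hc, rayShare_of_le hd, rayShare_of_le he, rayShare_five]
      exact ⟨by linarith, .inl (by linarith)⟩
    all_goals unfold SupportPattern; omega
  · rw [zero (n₀ := b), zero (n₀ := d), zero (n₀ := e), zero (n₁ := b), zero (n₁ := d)]
    · have := dartShare_three hb hd he (by omega)
      rw [rayShare_of_le hb, rayShare_of_le hd, rayShare_of_le he, rayShare_five]
      exact ⟨by linarith, .inl (by linarith)⟩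
    all_goals unfold SupportPattern; omega
  -- Of three consecutive neighbors of degree five the middle one is never paid. The rays and the
  -- side share bring 7/8 + 7/16, more than 1 + 2/8.
  · rw [zero (n₀ := d), zero (n₀ := e), zero (n₁ := 5) (n₂ := d)]
    · have key : 7 / 8 ≤ dartShare d + dartShare e := by
        rcases dartShare_two hd he (by omega) with h | h <;> linarith
      have := sideShare_of_le hd he
      rw [rayShare_of_le hd, rayShare_of_le he, rayShare_five]
      exact ⟨by linarith, .inl (by linarith)⟩
    all_goals unfold SupportPattern; omega
  · have key := dartShare_two hc he (by omega)
    have key' : 7 / 8 ≤ dartShare c + dartShare e := by rcases key with h | h <;> linarith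
    rw [zero (n₀ := c), zero (n₀ := e), zero (n₁ := e)]
    · rw [rayShare_of_le hc, rayShare_of_le he, rayShare_five]
      refine ⟨by linarith, ?_⟩
      -- Payments occur here only if both major neighbors have degree at least 16; then the rays
      -- bring 5/4 and the two payments cost 1/4.
      by_cases hce : 16 ≤ c ∧ 16 ≤ e
      · have := five_eighths_le_dartShare hce.1
        have := five_eighths_le_dartShare hce.2
        exact .inl (by linarith)
      · rw [zero (n₁ := c), zero (n₁ := 5)]
        · rcases key with h | ⟨h, h'⟩
          · exact .inl (by linarith)
          · exact .inr ⟨by linarith, by unfold PoorPattern; omega⟩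
        all_goals unfold SupportPattern; omega
    all_goals unfold SupportPattern; omega

/-- For vertices with a non-triangular corner, where side shares need not come from edges between
neighbors. The worst case is two major neighbors, of degrees 16 and 8. -/
lemma HeavyPattern.rays {n₀ n₁ n₂ n₃ n₄ : ℕ} (h : HeavyPattern n₀ n₁ n₂ n₃ n₄) :
    7 / 8 ≤ rayShare n₀ + rayShare n₁ + rayShare n₂ + rayShare n₃ + rayShare n₄ := by
  rcases h.someRotation with h | h | h | h | h <;>
    linarith [(patternBalance_nonneg_or_poor_of_normal h.1 h.2).1]

lemma HeavyPattern.balance {n₀ n₁ n₂ n₃ n₄ : ℕ} (h : HeavyPattern n₀ n₁ n₂ n₃ n₄) :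
    0 ≤ patternBalance n₀ n₁ n₂ n₃ n₄ ∨ -(1 / 8) ≤ patternBalance n₀ n₁ n₂ n₃ n₄ ∧
      (SomeRotation PoorPattern n₀ n₁ n₂ n₃ n₄ ∨ SomeRotation PoorPattern n₀ n₄ n₃ n₂ n₁) := by
  have r0 := patternBalance_rotate n₀ n₁ n₂ n₃ n₄
  have r1 := patternBalance_rotate n₁ n₂ n₃ n₄ n₀
  have r2 := patternBalance_rotate n₂ n₃ n₄ n₀ n₁
  have r3 := patternBalance_rotate n₃ n₄ n₀ n₁ n₂
  rcases h.someRotation with h | h | h | h | h <;>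
  · have := (patternBalance_nonneg_or_poor_of_normal h.1 h.2).2
    try simp only [r3, r2, r1, r0] at this
    refine this.imp id fun h => ⟨h.1, ?_⟩
    unfold SomeRotation
    rcases h.2 with h | h
    · left; simp only [h, true_or, or_true]
    · right; simp only [h, true_or, or_true]
end SimpleGraph

/-! ### Euler's formula distributed over the darts. -/

namespace SimpleGraph
variable {V : Type*}

/-- Counting the values of a function by weighting every point with the inverse size of its fiber. -/
lemma _root_.Finset.sum_inv_card_fiber {α β : Type*} [DecidableEq β] (s : Finset α) (f : α → β) :
    ∑ a ∈ s, (1 : ℝ) / (s.filter (fun b => f b = f a)).card = (s.image f).card := by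
  rw [← Finset.sum_fiberwise_of_maps_to (t := s.image f) (g := f)
    (fun a ha => Finset.mem_image_of_mem f ha)]
  rw [Finset.card_eq_sum_ones, Nat.cast_sum]
  refine Finset.sum_congr rfl fun b hb => ?_
  obtain ⟨a, ha, rfl⟩ := Finset.mem_image.1 hb
  rw [Finset.sum_congr rfl (g := fun _ => (1 : ℝ) / (s.filter (fun b => f b = f a)).card)]
  · rw [Finset.sum_const, nsmul_eq_mul, Nat.cast_one, mul_one_div_cancel]
    exact_mod_cast (Finset.card_pos.2 ⟨a, by simp [ha]⟩).ne'
  · intro x hx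
    rw [(Finset.mem_filter.1 hx).2]

namespace RotationSystem
variable {G : SimpleGraph V} (R : G.RotationSystem)

lemma facePerm_apply (d : G.Dart) : R.facePerm d = R.rot d.symm := rfl

lemma facePerm_fst (d : G.Dart) : (R.facePerm d).fst = d.snd := R.rot_fst _

/-- The length of the facial walk through a dart. -/
noncomputable def faceLength (d : G.Dart) : ℕ := {e | R.facePerm.SameCycle d e}.ncard

lemma rot_inv_fst (d : G.Dart) : (R.rot⁻¹ d).fst = d.fst := by
  rw [← R.rot_fst (R.rot⁻¹ d)]
  exact congrArg (fun e : G.Dart => e.fst) (R.rot.apply_symm_apply d)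

lemma connectedComponentMk_facePerm (d : G.Dart) :
    G.connectedComponentMk (R.facePerm d).fst = G.connectedComponentMk d.fst := by
  rw [facePerm_fst]
  exact ConnectedComponent.sound d.adj.symm.reachable

lemma connectedComponentMk_of_sameCycle {d e : G.Dart} (h : R.facePerm.SameCycle d e) :
    G.connectedComponentMk e.fst = G.connectedComponentMk d.fst := by
  obtain ⟨n, rfl⟩ := h
  induction n with
  | zero => rfl
  | succ n ih =>
    rw [add_comm, zpow_add, zpow_one, Equiv.Perm.mul_apply, connectedComponentMk_facePerm, ih]
  | pred n ih =>
    have : R.facePerm ((R.facePerm ^ (-(n : ℤ) - 1)) d) = (R.facePerm ^ (-(n : ℤ))) d := by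
      rw [← Equiv.Perm.mul_apply, ← zpow_one_add]
      congr 2; ring
    rw [← ih, ← this, connectedComponentMk_facePerm]

variable [Fintype V] [DecidableRel G.Adj]

/-- Euler's formula for one component, summed over its darts. -/
lemma IsPlane.sum_component (h : R.IsPlane) (hdeg : ∀ v, 0 < G.degree v) (c : G.ConnectedComponent)
    [DecidableEq G.ConnectedComponent] :
    ∑ d : G.Dart with G.connectedComponentMk d.fst = c,
      ((3 : ℝ) - 6 / G.degree d.fst - 6 / R.faceLength d) = -12 := by
  classical
  set D : Finset G.Dart := Finset.univ.filter fun d => G.connectedComponentMk d.fst = c with hD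
  have hmem : ∀ d, d ∈ D ↔ G.connectedComponentMk d.fst = c := fun d => by simp [hD]
  have dart_at : ∀ v, ∃ d : G.Dart, d.fst = v := fun v => by
    obtain ⟨w, hw⟩ := (G.degree_pos_iff_exists_adj v).1 (hdeg v)
    exact ⟨⟨(v, w), hw⟩, rfl⟩
  have hV : ((D.image (fun d => d.fst)).card : ℝ) = c.supp.ncard := by
    rw [← Set.ncard_coe_finset]
    congr 2
    ext v
    simp only [Finset.coe_image, Set.mem_image, Finset.mem_coe, hmem, ConnectedComponent.mem_supp_iff]
    constructor
    · rintro ⟨d, hd, rfl⟩; exact hd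
    · intro hv; obtain ⟨d, rfl⟩ := dart_at v; exact ⟨d, hv, rfl⟩
  have hE : ((D.image (fun d => d.edge)).card : ℝ) = (G.edgesOf c).ncard := by
    rw [← Set.ncard_coe_finset]
    congr 2
    ext e
    simp only [Finset.coe_image, Set.mem_image, Finset.mem_coe, hmem, edgesOf, Set.mem_ofPred_eq,
      ConnectedComponent.mem_supp_iff]
    constructor
    · rintro ⟨d, hd, rfl⟩
      refine ⟨d.edge_mem, fun v hv => ?_⟩
      rcases Sym2.mem_iff.1 hv with rfl | rfl
      · exact hd
      · rw [← hd]; exact ConnectedComponent.sound d.adj.symm.reachable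
    · induction e with | _ x y
      rintro ⟨he, hv⟩
      exact ⟨⟨(x, y), he⟩, hv x (by simp), rfl⟩
  have hF : ((D.image (fun d => {e | R.facePerm.SameCycle d e})).card : ℝ) = (R.facesOf c).ncard := by
    rw [← Set.ncard_coe_finset]
    congr 2
    ext f
    simp only [Finset.coe_image, Set.mem_image, Finset.mem_coe, hmem, facesOf, Set.mem_ofPred_eq,
      ConnectedComponent.mem_supp_iff, eq_comm]
  -- Vertices, edges and faces are the images of the darts under three maps, with fibers of size
  -- degree, 2 and face length.
  rw [← Finset.sum_inv_card_fiber] at hV hE hF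
  have hV' : ∑ d ∈ D, (1 : ℝ) / G.degree d.fst = c.supp.ncard := by
    rw [← hV]
    refine Finset.sum_congr rfl fun d hd => ?_
    rw [← dart_fst_fiber_card_eq_degree]
    congr 3
    ext e
    simp only [Finset.mem_filter, hmem, Finset.mem_univ, true_and]
    exact ⟨fun h => ⟨by rw [h]; exact (hmem d).1 hd, h⟩, fun h => h.2⟩
  have hE' : ∑ d ∈ D, (1 : ℝ) / 2 = (G.edgesOf c).ncard := by
    rw [← hE]
    refine Finset.sum_congr rfl fun d hd => ?_
    have := G.dart_edge_fiber_card d.edge d.edge_mem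
    rw [show D.filter (fun b => b.edge = d.edge) = Finset.univ.filter (fun b => b.edge = d.edge) from ?_,
      this, Nat.cast_ofNat]
    ext e
    simp only [Finset.mem_filter, hmem, Finset.mem_univ, true_and, and_iff_right_iff_imp]
    intro h
    rw [← (hmem d).1 hd]
    rcases (dart_edge_eq_iff e d).1 h with rfl | rfl
    · rfl
    · exact ConnectedComponent.sound d.adj.symm.reachable
  have hF' : ∑ d ∈ D, (1 : ℝ) / R.faceLength d = (R.facesOf c).ncard := by
    rw [← hF]
    refine Finset.sum_congr rfl fun d hd => ?_
    rw [faceLength, ← Set.ncard_coe_finset]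
    congr 3
    ext e
    simp only [Set.mem_ofPred_eq, Finset.coe_filter, hmem]
    constructor
    · intro h
      refine ⟨by rw [R.connectedComponentMk_of_sameCycle h]; exact (hmem d).1 hd, ?_⟩
      ext x; exact ⟨fun hx => h.trans hx, fun hx => h.symm.trans hx⟩
    · rintro ⟨-, h⟩
      have : e ∈ {x | R.facePerm.SameCycle e x} := Equiv.Perm.SameCycle.refl _ _
      rw [h] at this; exact this
  obtain ⟨v, hv⟩ := c.exists_rep
  obtain ⟨d, rfl⟩ := dart_at v
  have euler : ((c.supp.ncard : ℝ) + (R.facesOf c).ncard) = (G.edgesOf c).ncard + 2 := by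
    exact_mod_cast h c ⟨d, hv⟩
  have split : ∑ d ∈ D, ((3 : ℝ) - 6 / G.degree d.fst - 6 / R.faceLength d) =
      6 * ∑ d ∈ D, (1 : ℝ) / 2 - 6 * ∑ d ∈ D, (1 : ℝ) / G.degree d.fst -
        6 * ∑ d ∈ D, (1 : ℝ) / R.faceLength d := by
    rw [Finset.mul_sum, Finset.mul_sum, Finset.mul_sum, ← Finset.sum_sub_distrib,
      ← Finset.sum_sub_distrib]
    exact Finset.sum_congr rfl fun _ _ => by ring
  rw [split, hV', hE', hF']
  linarith

/-- The total charge of a plane graph is negative. -/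
lemma IsPlane.sum_neg [Nonempty V] (h : R.IsPlane) (hdeg : ∀ v, 0 < G.degree v) :
    ∑ d : G.Dart, ((3 : ℝ) - 6 / G.degree d.fst - 6 / R.faceLength d) < 0 := by
  classical
  rw [← Finset.sum_fiberwise (s := Finset.univ) (g := fun d : G.Dart => G.connectedComponentMk d.fst)]
  refine Finset.sum_neg (fun c _ => ?_) ⟨G.connectedComponentMk (Classical.arbitrary V), Finset.mem_univ _⟩
  rw [h.sum_component R hdeg c]
  norm_num

/-! ### Face lengths, corners and the darts at a vertex of degree five. -/

lemma rot_ne_self {d : G.Dart} (h : 2 ≤ G.degree d.fst) : R.rot d ≠ d := by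
  classical
  intro hd
  have : ∀ e : G.Dart, e.fst = d.fst → e = d := fun e he => by
    obtain ⟨n, hn⟩ := R.rot_cyclic d e he.symm
    rw [← hn, Equiv.Perm.zpow_apply_eq_self_of_apply_eq_self hd]
  rw [← dart_fst_fiber_card_eq_degree] at h
  obtain ⟨a, ha, b, hb, hab⟩ := Finset.one_lt_card.1 h
  simp only [Finset.mem_filter, Finset.mem_univ, true_and] at ha hb
  exact hab ((this a ha).trans (this b hb).symm)

/-- The corner between `d` and the next dart belongs to a triangular face. -/
def TriangularCorner (d : G.Dart) : Prop :=
  R.rot (R.rot (R.rot d).symm).symm = d.symm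

/-- Face tracing has no fixed point, as there are no loops. If it returned after two steps,
simplicity would make the second dart the reversal of the first, hence a fixed point of `rot`. -/
lemma three_le_faceLength (hdeg : ∀ v, 2 ≤ G.degree v) (d : G.Dart) :
    3 ≤ R.faceLength d ∧ (R.facePerm (R.facePerm (R.facePerm d)) ≠ d → 4 ≤ R.faceLength d) := by
  classical
  have hfin : {e | R.facePerm.SameCycle d e}.Finite := Set.toFinite _
  have c0 : R.facePerm.SameCycle d d := .refl _ _
  have c1 : R.facePerm.SameCycle d (R.facePerm d) := Equiv.Perm.sameCycle_apply_right.2 c0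
  have c2 : R.facePerm.SameCycle d (R.facePerm (R.facePerm d)) := Equiv.Perm.sameCycle_apply_right.2 c1
  have c3 : R.facePerm.SameCycle d (R.facePerm (R.facePerm (R.facePerm d))) :=
    Equiv.Perm.sameCycle_apply_right.2 c2
  have n1 : ∀ d, R.facePerm d ≠ d := fun d h => by
    have := R.facePerm_fst d
    rw [h] at this
    exact d.adj.ne this
  have n2 : ∀ d, R.facePerm (R.facePerm d) ≠ d := fun d h => by
    have h1 := R.facePerm_fst (R.facePerm d)
    rw [h] at h1
    have h2 : R.facePerm d = d.symm := by
      ext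
      · exact R.facePerm_fst d
      · exact h1.symm
    exact R.rot_ne_self (hdeg _) h2
  have inj := R.facePerm.injective
  constructor
  · have : ({d, R.facePerm d, R.facePerm (R.facePerm d)} : Finset G.Dart).card = 3 :=
      Finset.card_eq_three.2 ⟨_, _, _, (n1 d).symm, (n2 d).symm, (n1 _).symm, rfl⟩
    rw [← this, ← Set.ncard_coe_finset]
    refine Set.ncard_le_ncard (fun x hx => ?_) hfin
    simp only [Finset.coe_insert, Finset.coe_singleton, Set.mem_insert_iff, Set.mem_singleton_iff] at hx
    rcases hx with rfl | rfl | rfl <;> assumption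
  · intro n3
    have : ({d, R.facePerm d, R.facePerm (R.facePerm d), R.facePerm (R.facePerm (R.facePerm d))} :
        Finset G.Dart).card = 4 := by
      rw [Finset.card_insert_of_notMem, Finset.card_eq_three.2
        ⟨_, _, _, (n1 _).symm, (n2 _).symm, (n1 _).symm, rfl⟩]
      simp only [Finset.mem_insert, Finset.mem_singleton, not_or]
      exact ⟨(n1 d).symm, (n2 d).symm, n3.symm⟩
    rw [← this, ← Set.ncard_coe_finset]
    refine Set.ncard_le_ncard (fun x hx => ?_) hfin
    simp only [Finset.coe_insert, Finset.coe_singleton, Set.mem_insert_iff, Set.mem_singleton_iff] at hx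
    rcases hx with rfl | rfl | rfl | rfl <;> assumption

/-- The charge of the corner between `d` and the next dart, as a part of the charge of its face. -/
noncomputable def cornerShare (d : G.Dart) : ℝ := 2 - 6 / R.faceLength d.symm

lemma cornerShare_nonneg (hdeg : ∀ v, 2 ≤ G.degree v) (d : G.Dart) : 0 ≤ R.cornerShare d := by
  have : (3 : ℝ) ≤ R.faceLength d.symm := by exact_mod_cast (R.three_le_faceLength hdeg d.symm).1
  rw [cornerShare, sub_nonneg, div_le_iff₀ (by positivity)]
  linarith

lemma half_le_cornerShare (hdeg : ∀ v, 2 ≤ G.degree v) {d : G.Dart} (h : ¬ R.TriangularCorner d) :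
    1 / 2 ≤ R.cornerShare d := by
  have h4 := (R.three_le_faceLength hdeg d.symm).2 (by simpa [facePerm_apply, TriangularCorner] using h)
  have : (4 : ℝ) ≤ R.faceLength d.symm := by exact_mod_cast h4
  rw [cornerShare, le_sub_comm, div_le_iff₀ (by positivity)]
  linarith

open Classical in
/-- The five darts that leave a vertex of degree five. -/
lemma filter_fst_eq {d : G.Dart} (h : G.degree d.fst = 5) :
    R.rot (R.rot (R.rot (R.rot (R.rot d)))) = d ∧
    ∀ F : G.Dart → ℝ, ∑ e with e.fst = d.fst, F e = F d + F (R.rot d) + F (R.rot (R.rot d)) +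
      F (R.rot (R.rot (R.rot d))) + F (R.rot (R.rot (R.rot (R.rot d)))) := by
  set s : Finset G.Dart := Finset.univ.filter fun e => e.fst = d.fst with hs
  have hcard : s.card = 5 := by
    rw [← h, ← dart_fst_fiber_card_eq_degree]
  have hcyc : R.rot.IsCycleOn s := by
    refine ⟨⟨fun x hx => ?_, R.rot.injective.injOn, fun x hx => ⟨R.rot⁻¹ x, ?_, by simp⟩⟩, ?_⟩
    · simpa [hs, R.rot_fst] using hx
    · have := R.rot_inv_fst x
      simp_all
    · intro x hx y hy
      simp only [hs, Finset.coe_filter, Finset.mem_univ, true_and, Set.mem_ofPred_eq] at hx hy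
      exact R.rot_cyclic _ _ (hx.trans hy.symm)
  have hd : d ∈ s := by simp [hs]
  have h5 := hcyc.pow_card_apply hd
  rw [hcard] at h5
  refine ⟨by simpa [pow_succ] using h5, fun F => ?_⟩
  have himg : (Finset.range 5).image (fun n => (R.rot ^ n) d) = s := by
    refine Finset.eq_of_subset_of_card_le ?_ ?_
    · intro x hx
      obtain ⟨n, -, rfl⟩ := Finset.mem_image.1 hx
      exact_mod_cast hcyc.1.mapsTo.perm_pow n hd
    · refine Finset.card_le_card fun x hx => ?_
      obtain ⟨n, hn, rfl⟩ := hcyc.exists_pow_eq hd hx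
      exact Finset.mem_image.2 ⟨n, by simpa [hcard] using hn, rfl⟩
  rw [← himg, Finset.sum_image]
  · simp [Finset.sum_range_succ, pow_succ]
  · refine Finset.card_image_iff.1 ?_
    rw [himg, hcard, Finset.card_range]

end RotationSystem
end SimpleGraph

/-! ### Triangular corners and the support of poor vertices. -/

namespace SimpleGraph
variable {V : Type*} {G : SimpleGraph V}

lemma degree_eq_of_eq [Fintype V] [DecidableRel G.Adj] {v w : V} {n : ℕ} (h : v = w)
    (hw : G.degree w = n) : G.degree v = n := by rwa [h]

namespace RotationSystem

variable (R : G.RotationSystem)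

/-- All corners at `v` belong to triangular faces. -/
def Flat (v : V) : Prop := ∀ e : G.Dart, e.fst = v → R.TriangularCorner e

variable {R}

lemma TriangularCorner.snd_eq {e : G.Dart} (h : R.TriangularCorner e) :
    (R.rot (R.rot e).symm).snd = e.snd := by
  have := R.rot_fst (R.rot (R.rot e).symm).symm
  rw [h] at this
  exact this.symm

lemma TriangularCorner.snd_eq' {e : G.Dart} (h : R.TriangularCorner e) :
    (R.rot.symm e.symm).snd = (R.rot e).snd := by
  rw [← h, Equiv.symm_apply_apply]
  exact R.rot_fst _

variable [Fintype V] [DecidableRel G.Adj]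

/-- The degrees of the neighbors around the initial vertex of `d`, in the order given by `ρ` from `d` on,
have property `P`. -/
def PatternAt (P : ℕ → ℕ → ℕ → ℕ → ℕ → Prop) (ρ : Equiv.Perm G.Dart) (d : G.Dart) : Prop :=
  P (G.degree d.snd) (G.degree (ρ d).snd) (G.degree (ρ (ρ d)).snd) (G.degree (ρ (ρ (ρ d))).snd)
    (G.degree (ρ (ρ (ρ (ρ d)))).snd)

variable (R)

/-- Either `ρ` or its inverse is the rotation, every vertex of degree five is heavy, and the rotation is
known at the vertices all of whose corners are triangular. -/
structure IsHeavyRotation (ρ : Equiv.Perm G.Dart) : Prop where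
  fst : ∀ d, (ρ d).fst = d.fst
  five : ∀ d, G.degree d.fst = 5 → ρ (ρ (ρ (ρ (ρ d)))) = d
  heavy : ∀ d, G.degree d.fst = 5 → PatternAt HeavyPattern ρ d
  snd_eq : ∀ d, R.Flat d.fst → (ρ (ρ d).symm).snd = d.snd
  snd_eq' : ∀ d, R.Flat d.fst → (ρ.symm d.symm).snd = (ρ d).snd

variable {R}

lemma IsHeavyRotation.symm_apply {ρ : Equiv.Perm G.Dart} (h : R.IsHeavyRotation ρ) {d : G.Dart}
    (hd : G.degree d.fst = 5) : ρ.symm d = ρ (ρ (ρ (ρ d))) :=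
  ρ.symm_apply_eq.2 (h.five d hd).symm

lemma IsHeavyRotation.symm_fst {ρ : Equiv.Perm G.Dart} (h : R.IsHeavyRotation ρ) (d : G.Dart) :
    (ρ.symm d).fst = d.fst := by
  conv_rhs => rw [← ρ.apply_symm_apply d, h.fst]

/-- The inverse rotation lists the neighbors of a vertex of degree five in the opposite order. -/
lemma IsHeavyRotation.patternAt_symm {ρ : Equiv.Perm G.Dart} (h : R.IsHeavyRotation ρ) {d : G.Dart}
    (hd : G.degree d.fst = 5) (P : ℕ → ℕ → ℕ → ℕ → ℕ → Prop) :
    PatternAt P ρ.symm d ↔ PatternAt (fun n₀ n₁ n₂ n₃ n₄ => P n₀ n₄ n₃ n₂ n₁) ρ d := by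
  have e1 := h.symm_apply hd
  have e2 : ρ.symm (ρ.symm d) = ρ (ρ (ρ d)) := by rw [e1, Equiv.symm_apply_apply]
  have e3 : ρ.symm (ρ.symm (ρ.symm d)) = ρ (ρ d) := by rw [e2, Equiv.symm_apply_apply]
  have e4 : ρ.symm (ρ.symm (ρ.symm (ρ.symm d))) = ρ d := by rw [e3, Equiv.symm_apply_apply]
  unfold PatternAt
  rw [e4, e3, e2, e1]

/-- Poor patterns are not mirror symmetric; this lets one argument serve both orientations. -/
lemma IsHeavyRotation.symm {ρ : Equiv.Perm G.Dart} (h : R.IsHeavyRotation ρ) :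
    R.IsHeavyRotation ρ.symm where
  fst := h.symm_fst
  five d hd := by
    simp only [Equiv.symm_apply_eq]
    exact (h.five d hd).symm
  heavy d hd := by
    have H := h.heavy d hd
    rw [h.patternAt_symm hd]
    obtain ⟨a, b, c, d, e, f, g, i, j, k, l⟩ := H
    constructor <;> first | assumption | omega
  snd_eq d hd := by
    have := h.snd_eq' (ρ.symm d) (by rwa [h.symm_fst])
    rwa [Equiv.apply_symm_apply] at this
  snd_eq' d hd := by
    have := h.snd_eq (ρ.symm d) (by rwa [h.symm_fst])
    rwa [Equiv.apply_symm_apply] at this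

/-- A poor vertex has a neighbor that supports it. -/
lemma IsHeavyRotation.exists_support {ρ : Equiv.Perm G.Dart} (h : R.IsHeavyRotation ρ) {e : G.Dart}
    (he : G.degree e.fst = 5) (hflat : R.Flat e.fst) (hp : PatternAt PoorPattern ρ e) :
    ∃ k : G.Dart, k.fst = e.fst ∧ G.degree k.snd = 5 ∧
      (¬ R.Flat k.snd ∨ PatternAt SupportPattern ρ k.symm) := by
  obtain ⟨p0, p1, p2, p2', p3, p4⟩ := hp
  set e2 := ρ (ρ e) with he2
  set e3 := ρ e2 with he3
  set e4 := ρ e3 with he4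
  have f2 : e2.fst = e.fst := by rw [he2, h.fst, h.fst]
  have f3 : e3.fst = e.fst := by rw [he3, h.fst, f2]
  have f4 : e4.fst = e.fst := by rw [he4, h.fst, f3]
  by_cases fl3 : R.Flat e3.snd
  swap
  · exact ⟨e3, f3, p3, .inl fl3⟩
  by_cases fl4 : R.Flat e4.snd
  swap
  · exact ⟨e4, f4, p4, .inl fl4⟩
  have e5 : ρ e4 = e := h.five e he
  have k1 : (ρ e3.symm).snd = e2.snd := h.snd_eq e2 (by rwa [f2])
  have k4 : (ρ.symm e3.symm).snd = e4.snd := h.snd_eq' e3 (by rwa [f3])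
  have l1 : (ρ e4.symm).snd = e3.snd := h.snd_eq e3 (by rwa [f3])
  have l4 : (ρ.symm e4.symm).snd = e.snd := by rw [h.snd_eq' e4 (by rwa [f4]), e5]
  -- With x and y the ends of `e3` and `e4`, both sides are the dart from y to x.
  have hl : ρ e4.symm = (ρ.symm e3.symm).symm := by
    ext
    · exact (h.fst _).trans k4.symm
    · exact l1.trans (h.symm_fst e3.symm).symm
  have d3 : G.degree e3.symm.fst = 5 := p3
  have d4 : G.degree e4.symm.fst = 5 := p4
  -- The triangle beyond the edge xy has a third vertex z, seen in position 2 around y and position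
  -- 3 around x.
  have hr : (ρ (ρ e4.symm)).snd = (ρ (ρ (ρ e3.symm))).snd := by
    have key := h.snd_eq (ρ (ρ (ρ e3.symm))) (by rw [h.fst, h.fst, h.fst]; exact fl3)
    rwa [← h.symm_apply d3, ← hl] at key
  have H3 := h.heavy _ d3
  have H4 := h.heavy _ d4
  rw [h.symm_apply d3] at k4
  rw [h.symm_apply d4] at l4
  unfold PatternAt at H3 H4
  rw [k1, k4, ← hr] at H3
  rw [l1, l4] at H4
  -- Let w be the remaining neighbor of x. If z has degree five, y supports, its last neighbor being
  -- major by heaviness. If z and w are both major, x supports. If only z is major, heaviness of x,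
  -- whose other neighbors have degrees 5, 5, 5 and at most 9, forces degree at least 16 on z, and y
  -- supports.
  have goal3 : SupportPattern (G.degree e3.symm.snd) (G.degree e2.snd) (G.degree (ρ (ρ e3.symm)).snd)
      (G.degree (ρ (ρ e4.symm)).snd) (G.degree e4.snd) ∨
      SupportPattern (G.degree e4.symm.snd) (G.degree e3.snd) (G.degree (ρ (ρ e4.symm)).snd)
        (G.degree (ρ (ρ (ρ e4.symm))).snd) (G.degree e.snd) := by
    have d3' : G.degree e3.symm.snd = 5 := degree_eq_of_eq f3 he
    have d4' : G.degree e4.symm.snd = 5 := degree_eq_of_eq f4 he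
    rw [d3', p4] at H3
    rw [d4', p3] at H4
    rw [d3', d4', p3, p4]
    have a1 := H3.heavy
    have a2 := H3.h₂
    have a3 := H3.h₃
    have a4 := H4.h₃
    have a5 := H4.major₄
    unfold SupportPattern
    omega
  rcases goal3 with g | g
  · refine ⟨e3, f3, p3, .inr ?_⟩
    unfold PatternAt
    rwa [k1, k4, ← hr]
  · refine ⟨e4, f4, p4, .inr ?_⟩
    unfold PatternAt
    rwa [l1, l4]

/-! ### The redistribution of charge and the final charges. -/

variable (R)

/-- The initial vertex of the dart pays `1 / 8` to its terminal vertex. -/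
def Supports (d : G.Dart) : Prop :=
  G.degree d.fst = 5 ∧ G.degree d.snd = 5 ∧
    (¬ R.Flat d.fst ∨ PatternAt SupportPattern R.rot d ∨ PatternAt SupportPattern R.rot.symm d)

open Classical in
/-- The amount that the initial vertex of the dart pays to its terminal vertex. -/
noncomputable def payment (d : G.Dart) : ℝ := if R.Supports d then 1 / 8 else 0

/-- What is left at a dart, as a part of the charge of its initial vertex, and received along it. -/
noncomputable def _root_.SimpleGraph.directShare (d : G.Dart) : ℝ :=
  if G.degree d.fst = 5 then -(1 / 5) + rayShare (G.degree d.snd) else 0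

lemma payment_nonneg (d : G.Dart) : 0 ≤ R.payment d := by
  unfold payment; split_ifs <;> norm_num

lemma payment_le (d : G.Dart) : R.payment d ≤ 1 / 8 := by
  unfold payment; split_ifs <;> norm_num

lemma sum_comp_symm (f : G.Dart → ℝ) : ∑ d : G.Dart, f d.symm = ∑ d : G.Dart, f d :=
  Equiv.sum_comp (Dart.symm_involutive (G := G)).toPerm f

/-- Redistribution preserves the total charge. -/
lemma sum_directShare_add_sideShare (h : ∀ v, G.degree v = 5 ∨ 8 ≤ G.degree v) :
    ∑ d : G.Dart, directShare d + ∑ d : G.Dart, sideShare (G.degree d.snd) (G.degree d.fst) =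
      ∑ d : G.Dart, dartShare (G.degree d.fst) := by
  -- `a` and `b` split the share of a major vertex according to whether the other end has degree
  -- five or is major; `c` spreads the charge -1 over five darts. Redistribution moves `a`, and half
  -- of `b`, to the reversed dart.
  let a : G.Dart → ℝ := fun d => if G.degree d.snd = 5 then rayShare (G.degree d.fst) else 0
  let b : G.Dart → ℝ := fun d => if 8 ≤ G.degree d.snd then rayShare (G.degree d.fst) else 0
  let c : G.Dart → ℝ := fun d => if G.degree d.fst = 5 then -(1 / 5) else 0
  have h1 : ∀ d : G.Dart, directShare d = c d + a d.symm := fun d => by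
    change directShare d = c d + if G.degree d.fst = 5 then rayShare (G.degree d.snd) else 0
    simp only [directShare, c]
    split_ifs <;> simp
  have h2 : ∀ d : G.Dart, sideShare (G.degree d.snd) (G.degree d.fst) = b d / 2 + b d.symm / 2 :=
    fun d => by
      change _ = b d / 2 + (if 8 ≤ G.degree d.fst then rayShare (G.degree d.snd) else 0) / 2
      simp only [sideShare, rayShare, b]
      split_ifs <;> first | (exfalso; omega) | ring
  have h3 : ∀ d : G.Dart, dartShare (G.degree d.fst) = c d + a d + b d := fun d => by
    rcases h d.fst with hf | hf <;> rcases h d.snd with hs | hs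
    · simp [a, b, c, hf, hs, rayShare, dartShare]; norm_num
    · have : G.degree d.snd ≠ 5 := by omega
      simp [a, b, c, hf, this, rayShare, dartShare]; norm_num
    · have : G.degree d.fst ≠ 5 := by omega
      simp [a, b, c, hf, this, hs, rayShare]
    · have : G.degree d.fst ≠ 5 := by omega
      have : G.degree d.snd ≠ 5 := by omega
      simp [a, b, c, *, rayShare]
  simp only [h1, h2, h3, Finset.sum_add_distrib]
  rw [sum_comp_symm a, sum_comp_symm (fun d => b d / 2), ← Finset.sum_div]
  ring

/-- The part of the final charge of the initial vertex of a dart that falls on the dart, without the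
payments received. -/
noncomputable def dartBalance (d : G.Dart) : ℝ :=
  directShare d + sideShare (G.degree (R.rot (R.rot d).symm).snd) (G.degree (R.rot d).snd) +
    R.cornerShare d - R.payment d

/-- The total final charge is negative. -/
lemma sum_dartBalance_neg [Nonempty V] (hplane : R.IsPlane)
    (h : ∀ v, G.degree v = 5 ∨ 8 ≤ G.degree v) :
    ∑ d : G.Dart, (R.dartBalance d + R.payment d.symm) < 0 := by
  have neg := hplane.sum_neg R fun v => by have := h v; omega
  have split : ∑ d : G.Dart, ((3 : ℝ) - 6 / G.degree d.fst - 6 / R.faceLength d) =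
      ∑ d : G.Dart, dartShare (G.degree d.fst) + ∑ d : G.Dart, (2 - 6 / (R.faceLength d : ℝ)) := by
    rw [← Finset.sum_add_distrib]
    exact Finset.sum_congr rfl fun _ _ => by unfold dartShare; ring
  have side : ∑ d : G.Dart, sideShare (G.degree (R.rot (R.rot d).symm).snd) (G.degree (R.rot d).snd) =
      ∑ d : G.Dart, sideShare (G.degree d.snd) (G.degree d.fst) := by
    -- This permutation sends a dart to the one facing its corner, so each side of each edge is
    -- assigned exactly once.
    rw [← Equiv.sum_comp (R.rot.trans R.facePerm)
      (fun d : G.Dart => sideShare (G.degree d.snd) (G.degree d.fst))]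
    refine Finset.sum_congr rfl fun d _ => ?_
    rw [Equiv.trans_apply, facePerm_fst]
    rfl
  simp only [dartBalance, Finset.sum_add_distrib, Finset.sum_sub_distrib]
  rw [sum_comp_symm R.payment, side, sum_directShare_add_sideShare h,
    show ∑ d : G.Dart, R.cornerShare d = ∑ d : G.Dart, (2 - 6 / (R.faceLength d : ℝ)) from
      sum_comp_symm fun d => 2 - 6 / (R.faceLength d : ℝ)]
  linarith

variable {R}

lemma payment_of_flat {d : G.Dart} (hR : R.IsHeavyRotation R.rot) (hd : G.degree d.fst = 5)
    (hflat : R.Flat d.fst) :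
    R.payment d = patternPayment (G.degree d.snd) (G.degree (R.rot d).snd)
      (G.degree (R.rot (R.rot d)).snd) (G.degree (R.rot (R.rot (R.rot d))).snd)
      (G.degree (R.rot (R.rot (R.rot (R.rot d)))).snd) := by
  unfold payment patternPayment
  congr 1
  rw [eq_iff_iff]
  unfold Supports
  rw [hR.patternAt_symm hd]
  refine ⟨fun h => ?_, fun h => ⟨hd, ?_, .inr h⟩⟩
  · exact h.2.2.resolve_left (not_not_intro hflat)
  · rcases h with h | h <;> exact h.1

lemma payment_symm_of_support (hR : R.IsHeavyRotation R.rot) {ρ : Equiv.Perm G.Dart}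
    (hρ : ρ = R.rot ∨ ρ = R.rot.symm) {e : G.Dart}
    (he : G.degree e.fst = 5) (hflat : R.Flat e.fst) (hp : PatternAt PoorPattern ρ e) :
    ∃ k : G.Dart, k.fst = e.fst ∧ R.payment k.symm = 1 / 8 := by
  have h : R.IsHeavyRotation ρ := by
    rcases hρ with rfl | rfl
    · exact hR
    · exact hR.symm
  obtain ⟨k, hk, hk5, hk'⟩ := h.exists_support he hflat hp
  refine ⟨k, hk, if_pos ⟨hk5, degree_eq_of_eq hk he, ?_⟩⟩
  rcases hk' with hk' | hk'
  · exact .inl hk'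
  · rcases hρ with rfl | rfl
    · exact .inr (.inl hk')
    · exact .inr (.inr hk')

/-- A pattern that occurs in some rotation around a vertex occurs at some dart. -/
lemma IsHeavyRotation.exists_patternAt {ρ : Equiv.Perm G.Dart} (h : R.IsHeavyRotation ρ)
    {P : ℕ → ℕ → ℕ → ℕ → ℕ → Prop} {d : G.Dart} (hd : G.degree d.fst = 5)
    (hP : PatternAt (SomeRotation P) ρ d) : ∃ e : G.Dart, e.fst = d.fst ∧ PatternAt P ρ e := by
  have f := h.five d hd
  rcases hP with hP | hP | hP | hP | hP
  · exact ⟨d, rfl, hP⟩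
  · refine ⟨ρ d, by simp only [h.fst], ?_⟩
    unfold PatternAt; rwa [f]
  · refine ⟨ρ (ρ d), by simp only [h.fst], ?_⟩
    unfold PatternAt; rwa [f]
  · refine ⟨ρ (ρ (ρ d)), by simp only [h.fst], ?_⟩
    unfold PatternAt; rwa [f]
  · refine ⟨ρ (ρ (ρ (ρ d))), by simp only [h.fst], ?_⟩
    unfold PatternAt; rwa [f]

open Classical in
/-- The final charge of a heavy vertex of degree five is nonnegative. -/
lemma sum_nonneg_of_degree_eq_five (hR : R.IsHeavyRotation R.rot) (hdeg : ∀ v, 2 ≤ G.degree v)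
    {d : G.Dart} (hd : G.degree d.fst = 5) :
    0 ≤ ∑ e : G.Dart with e.fst = d.fst, (R.dartBalance e + R.payment e.symm) := by
  have hsum := (R.filter_fst_eq hd).2
  have heavy := hR.heavy d hd
  have received : 0 ≤ ∑ e : G.Dart with e.fst = d.fst, R.payment e.symm :=
    Finset.sum_nonneg fun e _ => R.payment_nonneg _
  have corners : 0 ≤ ∑ e : G.Dart with e.fst = d.fst, R.cornerShare e :=
    Finset.sum_nonneg fun e _ => R.cornerShare_nonneg hdeg e
  have direct : ∀ e : G.Dart, e.fst = d.fst → directShare e = -(1 / 5) + rayShare (G.degree e.snd) :=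
    fun e he => if_pos (degree_eq_of_eq he hd)
  have f1 : (R.rot d).fst = d.fst := R.rot_fst d
  have f2 : (R.rot (R.rot d)).fst = d.fst := (R.rot_fst _).trans f1
  have f3 : (R.rot (R.rot (R.rot d))).fst = d.fst := (R.rot_fst _).trans f2
  have f4 : (R.rot (R.rot (R.rot (R.rot d)))).fst = d.fst := (R.rot_fst _).trans f3
  have five := hR.five d hd
  simp only [dartBalance, Finset.sum_add_distrib, Finset.sum_sub_distrib]
  rw [hsum directShare, direct d rfl, direct _ f1, direct _ f2, direct _ f3, direct _ f4]
  by_cases hflat : R.Flat d.fst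
  · have side : ∀ e : G.Dart, e.fst = d.fst →
        sideShare (G.degree (R.rot (R.rot e).symm).snd) (G.degree (R.rot e).snd) =
          sideShare (G.degree e.snd) (G.degree (R.rot e).snd) := fun e he => by
      rw [(hflat e he).snd_eq]
    have pay : ∀ e : G.Dart, e.fst = d.fst → R.payment e = _ := fun e he =>
      payment_of_flat hR (degree_eq_of_eq he hd) (by rwa [he])
    rw [hsum R.payment, pay d rfl, pay _ f1, pay _ f2, pay _ f3, pay _ f4,
      hsum fun e => sideShare (G.degree (R.rot (R.rot e).symm).snd) (G.degree (R.rot e).snd),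
      side d rfl, side _ f1, side _ f2, side _ f3, side _ f4, five]
    have bal := heavy.balance
    unfold patternBalance at bal
    rcases bal with bal | ⟨bal, poor⟩
    · linarith
    · have : ∃ k : G.Dart, k.fst = d.fst ∧ R.payment k.symm = 1 / 8 := by
        rcases poor with poor | poor
        · obtain ⟨e, he, he'⟩ := hR.exists_patternAt hd poor
          rw [← he] at hflat hd ⊢
          exact payment_symm_of_support hR (.inl rfl) hd hflat he'
        · have poor' := (hR.patternAt_symm hd (SomeRotation PoorPattern)).2 poor
          obtain ⟨e, he, he'⟩ := hR.symm.exists_patternAt hd poor'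
          rw [← he] at hflat hd ⊢
          exact payment_symm_of_support hR (.inr rfl) hd hflat he'
      obtain ⟨k, hk, hk'⟩ := this
      have := Finset.single_le_sum (f := fun e : G.Dart => R.payment e.symm)
        (s := Finset.univ.filter fun e : G.Dart => e.fst = d.fst)
        (fun e _ => R.payment_nonneg _) (Finset.mem_filter.2 ⟨Finset.mem_univ k, hk⟩)
      simp only [hk'] at this
      linarith
  · have rays := heavy.rays
    have sides : 0 ≤ ∑ e : G.Dart with e.fst = d.fst,
        sideShare (G.degree (R.rot (R.rot e).symm).snd) (G.degree (R.rot e).snd) :=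
      Finset.sum_nonneg fun e _ => sideShare_nonneg _ _
    obtain ⟨k, hk, hk'⟩ : ∃ k : G.Dart, k.fst = d.fst ∧ ¬ R.TriangularCorner k := by
      unfold Flat at hflat
      push Not at hflat
      exact hflat
    have corner := Finset.single_le_sum (f := fun e : G.Dart => R.cornerShare e)
      (s := Finset.univ.filter fun e : G.Dart => e.fst = d.fst)
      (fun e _ => R.cornerShare_nonneg hdeg e) (Finset.mem_filter.2 ⟨Finset.mem_univ k, hk⟩)
    have := R.half_le_cornerShare hdeg hk'
    have zero : ∀ e : G.Dart, 8 ≤ G.degree e.snd → R.payment e = 0 := fun e he =>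
      if_neg fun h => by have := h.2.1; omega
    have q0 := R.payment_le d
    have q1 := R.payment_le (R.rot d)
    have q2 := R.payment_le (R.rot (R.rot d))
    have q3 := R.payment_le (R.rot (R.rot (R.rot d)))
    have q4 := R.payment_le (R.rot (R.rot (R.rot (R.rot d))))
    -- At least two neighbors are major and are not paid: `majorᵢ` yields one other than neighbor i.
    -- The account closes exactly: 7/8 + 1/2 - 3/8 = 1.
    have pays : ∑ e : G.Dart with e.fst = d.fst, R.payment e ≤ 3 / 8 := by
      rw [hsum R.payment]
      rcases heavy.major₀ with m | m | m | m
      · rcases heavy.major₁ with n | n | n | n <;> linarith [zero _ m, zero _ n]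
      · rcases heavy.major₂ with n | n | n | n <;> linarith [zero _ m, zero _ n]
      · rcases heavy.major₃ with n | n | n | n <;> linarith [zero _ m, zero _ n]
      · rcases heavy.major₄ with n | n | n | n <;> linarith [zero _ m, zero _ n]
    linarith

/-- Some vertex of degree five is not heavy. -/
lemma not_isHeavyRotation_rot [Nonempty V] (hplane : R.IsPlane)
    (h : ∀ v, G.degree v = 5 ∨ 8 ≤ G.degree v) : ¬ R.IsHeavyRotation R.rot := by
  classical
  intro hR
  have hdeg : ∀ v, 2 ≤ G.degree v := fun v => by have := h v; omega
  refine (R.sum_dartBalance_neg hplane h).not_ge ?_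
  rw [← Finset.sum_fiberwise (s := Finset.univ) (g := fun d : G.Dart => d.fst)]
  refine Finset.sum_nonneg fun v _ => ?_
  rcases h v with hv | hv
  · obtain ⟨w, hw⟩ := (G.degree_pos_iff_exists_adj v).1 (by omega)
    exact sum_nonneg_of_degree_eq_five hR hdeg (d := ⟨(v, w), hw⟩) hv
  · refine Finset.sum_nonneg fun d hd => ?_
    have hd' : G.degree d.fst ≠ 5 := by rw [(Finset.mem_filter.1 hd).2]; omega
    have pay : R.payment d = 0 := if_neg fun h => hd' h.1
    have direct : directShare d = 0 := if_neg hd'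
    have := R.payment_nonneg d.symm
    have := R.cornerShare_nonneg hdeg d
    have := sideShare_nonneg (G.degree (R.rot (R.rot d).symm).snd) (G.degree (R.rot d).snd)
    unfold dartBalance
    linarith

end RotationSystem

/-! ### Full stars, and heaviness in a counterexample. -/

/-- The star formed by a vertex and all its neighbors. -/
def starSubgraph (G : SimpleGraph V) (v : V) : G.Subgraph where
  verts := insert v (G.neighborSet v)
  Adj a b := G.Adj a b ∧ (a = v ∨ b = v)
  adj_sub h := h.1
  edge_vert := by
    rintro a b ⟨h, rfl | rfl⟩
    · exact .inl rfl
    · exact .inr h.symm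
  symm := ⟨fun _ _ h => ⟨h.1.symm, h.2.symm⟩⟩

section Star
variable [Fintype V] [DecidableRel G.Adj]

lemma isMinorStar_starSubgraph {v : V} (hv : G.degree v = 5) : (G.starSubgraph v).IsMinorStar 5 := by
  refine ⟨v, ⟨.inl rfl, ?_, fun a b => ⟨fun h => ?_, ?_⟩⟩, hv.le⟩
  · have : (G.starSubgraph v).verts \ {v} = (G.neighborFinset v : Set V) := by
      ext w
      simp only [starSubgraph, Set.mem_sdiff, Set.mem_insert_iff, mem_neighborSet, Set.mem_singleton_iff,
        coe_neighborFinset]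
      exact ⟨fun h => h.1.resolve_left h.2, fun h => ⟨.inr h, h.ne'⟩⟩
    rw [this, Set.ncard_coe_finset, card_neighborFinset_eq_degree, hv]
  · exact ⟨(G.starSubgraph v).edge_vert h, (G.starSubgraph v).edge_vert h.symm, h.1.ne, h.2⟩
  · rintro ⟨ha, hb, hab, rfl | rfl⟩
    · exact ⟨hb.resolve_left hab.symm, .inl rfl⟩
    · exact ⟨(ha.resolve_left hab).symm, .inr rfl⟩

open Classical in
lemma filter_mem_starSubgraph (v : V) :
    Finset.univ.filter (fun w => w ∈ (G.starSubgraph v).verts) = insert v (G.neighborFinset v) := by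
  ext w
  simp [starSubgraph]

lemma weight_starSubgraph (v : V) :
    (G.starSubgraph v).weight = G.degree v + ∑ w ∈ G.neighborFinset v, G.degree w := by
  classical
  unfold Subgraph.weight
  rw [filter_mem_starSubgraph, Finset.sum_insert (by simp)]

lemma height_starSubgraph_le {v : V} {n : ℕ} (hv : G.degree v ≤ n)
    (h : ∀ w, G.Adj v w → G.degree w ≤ n) : (G.starSubgraph v).height ≤ n := by
  classical
  unfold Subgraph.height
  rw [filter_mem_starSubgraph]
  refine Finset.sup_le fun w hw => ?_
  rcases Finset.mem_insert.1 hw with rfl | hw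
  · exact hv
  · exact h w (by simpa using hw)

open Classical in
lemma sum_neighborFinset_eq (v : V) (f : V → ℕ) :
    ∑ w ∈ G.neighborFinset v, f w = ∑ d : G.Dart with d.fst = v, f d.snd := by
  symm
  refine Finset.sum_bij (fun d _ => d.snd) ?_ ?_ ?_ ?_
  · intro d hd
    obtain rfl := (Finset.mem_filter.1 hd).2
    simp
  · intro d hd e he hde
    ext
    · rw [(Finset.mem_filter.1 hd).2, (Finset.mem_filter.1 he).2]
    · exact hde
  · intro w hw
    exact ⟨⟨(v, w), (G.mem_neighborFinset v w).1 hw⟩, by simp, rfl⟩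
  · intros; rfl

end Star

namespace RotationSystem
variable [Fintype V] [DecidableRel G.Adj] {R : G.RotationSystem}

/-- Any four of five neighbors are cyclically consecutive, so the excluded cyclic star bars four of
degree five. The full star has weight 5 plus the neighbor degrees; hence the threshold 40. -/
lemma heavyPattern_of_degree_eq_five (h : ∀ v, G.degree v = 5 ∨ 8 ≤ G.degree v)
    (hstar : ¬ R.HasCyclicStar ![5, 5, 5, 5, ⊤])
    (hno : ¬ ∃ H : G.Subgraph, H.IsMinorStar 5 ∧ H.weight ≤ 44 ∧ H.height ≤ 15)
    {d : G.Dart} (hd : G.degree d.fst = 5) : PatternAt HeavyPattern R.rot d := by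
  classical
  obtain ⟨five, hsum⟩ := R.filter_fst_eq hd
  have major : ∀ e : G.Dart, G.degree e.fst = 5 → 8 ≤ G.degree e.snd ∨ 8 ≤ G.degree (R.rot e).snd ∨
      8 ≤ G.degree (R.rot (R.rot e)).snd ∨ 8 ≤ G.degree (R.rot (R.rot (R.rot e))).snd := by
    intro e he
    by_contra! hlt
    obtain ⟨m0, m1, m2, m3⟩ := hlt
    have five_of_lt : ∀ v, G.degree v < 8 → G.degree v = 5 := fun v hv => by have := h v; omega
    refine hstar ⟨e, he, .inl fun i => ?_⟩
    fin_cases i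
    · exact Nat.cast_le.2 (five_of_lt _ m0).le
    · exact Nat.cast_le.2 (five_of_lt _ m1).le
    · exact Nat.cast_le.2 (five_of_lt _ m2).le
    · exact Nat.cast_le.2 (five_of_lt _ m3).le
    · simp
  have f1 : G.degree (R.rot d).fst = 5 := by rwa [R.rot_fst]
  have f2 : G.degree (R.rot (R.rot d)).fst = 5 := by rwa [R.rot_fst]
  have f3 : G.degree (R.rot (R.rot (R.rot d))).fst = 5 := by rwa [R.rot_fst]
  have f4 : G.degree (R.rot (R.rot (R.rot (R.rot d)))).fst = 5 := by rwa [R.rot_fst]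
  have m0 := major d hd
  have m1 := major _ f1
  have m2 := major _ f2
  have m3 := major _ f3
  have m4 := major _ f4
  rw [five] at m2 m3 m4
  rw [five] at *
  refine ⟨h _, h _, h _, h _, h _, ?_, by omega, by omega, by omega, by omega, by omega⟩
  by_contra! hlt
  obtain ⟨hw, b0, b1, b2, b3, b4⟩ := hlt
  refine hno ⟨G.starSubgraph d.fst, isMinorStar_starSubgraph hd, ?_, ?_⟩
  · have := hsum fun e => (G.degree e.snd : ℝ)
    rw [weight_starSubgraph, hd, sum_neighborFinset_eq]
    have : ∑ e : G.Dart with e.fst = d.fst, G.degree e.snd = G.degree d.snd + G.degree (R.rot d).snd +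
        G.degree (R.rot (R.rot d)).snd + G.degree (R.rot (R.rot (R.rot d))).snd +
        G.degree (R.rot (R.rot (R.rot (R.rot d)))).snd := by exact_mod_cast this
    omega
  · refine height_starSubgraph_le (by omega) fun w hw => ?_
    by_contra! hlt
    -- Summing the indicator of `w` shows that `w` must be one of the five listed neighbors.
    have key := hsum fun e => if e.snd = w then 1 else 0
    have hne : ∀ e : G.Dart, G.degree e.snd < 16 → e.snd ≠ w := fun e he hew => by
      rw [hew] at he; omega
    rw [if_neg (hne _ b0), if_neg (hne _ b1), if_neg (hne _ b2), if_neg (hne _ b3),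
      if_neg (hne _ b4)] at key
    have := Finset.single_le_sum (f := fun e : G.Dart => if e.snd = w then (1 : ℝ) else 0)
      (s := Finset.univ.filter fun e : G.Dart => e.fst = d.fst)
      (fun e _ => by split_ifs <;> norm_num)
      (Finset.mem_filter.2 ⟨Finset.mem_univ (⟨(d.fst, w), hw⟩ : G.Dart), rfl⟩)
    simp only [if_true] at this
    linarith

end RotationSystem
end SimpleGraph

theorem theorem15 {V : Type*} [Fintype V] (G : SimpleGraph V) [DecidableRel G.Adj]
    (R : G.RotationSystem) (hplane : R.IsPlane)
    (hmin : G.minDegree = 5)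
    (hstar : ¬ R.HasCyclicStar ![5, 5, 5, 5, ⊤])
    (h6 : ∀ v : V, G.degree v ≠ 6)
    (h7 : ∀ v : V, G.degree v ≠ 7) :
    ∃ H : G.Subgraph, H.IsMinorStar 5 ∧ H.weight ≤ 44 ∧ H.height ≤ 15 := by
  by_contra hno
  have h : ∀ v, G.degree v = 5 ∨ 8 ≤ G.degree v := fun v => by
    have := G.minDegree_le_degree v
    have := h6 v
    have := h7 v
    omega
  -- The minimum degree of the empty graph is 0 by convention.
  have : Nonempty V := by
    by_contra hV
    rw [not_nonempty_iff] at hV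
    simp at hmin
  refine SimpleGraph.RotationSystem.not_isHeavyRotation_rot hplane h
    ⟨R.rot_fst, fun d hd => (R.filter_fst_eq hd).1,
      fun d hd => SimpleGraph.RotationSystem.heavyPattern_of_degree_eq_five h hstar hno hd,
      fun d hd => (hd d rfl).snd_eq, fun d hd => (hd d rfl).snd_eq'⟩
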